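/- Let $n\ge 0$ be an integer and let $M\in\mathrm{GL}_n(\mathbb{C})$, with multiplicative Jordan decomposition $M=M_sM_u=M_uM_s$, where $M_s\in\mathrm{GL}_n(\mathbb{C})$ is semisimple (that is, diagonalizable) and $M_u\in\mathrm{GL}_n(\mathbb{C})$ is unipotent. For $A\in\mathrm{GL}_n(\mathbb{C})$ write $\langle A\rangle=\{A^k : k\in\mathbb{Z}\}$, and for a set $Y$ of $n\times n$ complex matrices let $\overline{Y}$ denote its Zariski closure in $\mathrm{Mat}_n(\mathbb{C})$, regarded as the affine space $\mathbb{C}^{n^2}$. Write $\dim$ for the dimension of an algebraic set (the supremum of the lengths of chains of irreducible closed subsets) and $\operatorname{irr}$ for its number of irreducible components. Then \[ \dim\overline{\langle M\rangle}=\dim\overline{\langle M_s\rangle}+\dim\overline{\langle M_u\rangle} \qquad\text{and}\qquad \operatorname{irr}\bigl(\overline{\langle M\rangle}\bigr)=\operatorname{irr}\bigl(\overline{\langle M_s\rangle}\bigr). \] -/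

import Mathlib

open scoped Matrix

/-- A set of complex `n × n` matrices is Zariski closed if it is the common zero set of a set of
polynomials in the `n²` matrix entries. -/
def IsZariskiClosed {n : ℕ} (Z : Set (Matrix (Fin n) (Fin n) ℂ)) : Prop :=
  ∃ S : Set (MvPolynomial (Fin n × Fin n) ℂ),
    Z = {A | ∀ p ∈ S, MvPolynomial.eval (fun ij : Fin n × Fin n => A ij.1 ij.2) p = 0}

theorem isZariskiClosed_empty {n : ℕ} :
    IsZariskiClosed (∅ : Set (Matrix (Fin n) (Fin n) ℂ)) :=
  ⟨{1}, by ext A; simp⟩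

theorem IsZariskiClosed.sInter {n : ℕ} (F : Set (Set (Matrix (Fin n) (Fin n) ℂ)))
    (hF : ∀ Z ∈ F, IsZariskiClosed Z) : IsZariskiClosed (⋂₀ F) := by
  refine ⟨{p | ∃ Z ∈ F, ∀ A ∈ Z,
    MvPolynomial.eval (fun ij : Fin n × Fin n => A ij.1 ij.2) p = 0}, ?_⟩
  ext A
  constructor
  · rintro hA p ⟨Z, hZ, hp⟩
    exact hp A (hA Z hZ)
  · intro hA Z hZ
    obtain ⟨S, rfl⟩ := hF Z hZ
    intro p hp
    exact hA p ⟨_, hZ, fun B hB => hB p hp⟩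

theorem IsZariskiClosed.union {n : ℕ} (Y Z : Set (Matrix (Fin n) (Fin n) ℂ))
    (hY : IsZariskiClosed Y) (hZ : IsZariskiClosed Z) : IsZariskiClosed (Y ∪ Z) := by
  obtain ⟨S, rfl⟩ := hY
  obtain ⟨T, rfl⟩ := hZ
  refine ⟨{r | ∃ p ∈ S, ∃ q ∈ T, r = p * q}, ?_⟩
  ext A
  constructor
  · rintro (hA | hA) r ⟨p, hp, q, hq, rfl⟩
    · rw [map_mul, hA p hp, zero_mul]
    · rw [map_mul, hA q hq, mul_zero]
  · intro hA
    by_contra hcon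
    simp only [Set.mem_union, Set.mem_ofPred_eq, not_or, not_forall] at hcon
    obtain ⟨⟨p, hp, hp0⟩, q, hq, hq0⟩ := hcon
    have h := hA (p * q) ⟨p, hp, q, hq, rfl⟩
    rw [map_mul] at h
    exact (mul_ne_zero hp0 hq0) h

/-- The Zariski topology on the space of complex `n × n` matrices, regarded as `ℂ^(n²)`. It is not
an instance, since matrices already carry the Euclidean topology. -/
@[reducible] def zariskiTopology (n : ℕ) : TopologicalSpace (Matrix (Fin n) (Fin n) ℂ) :=
  TopologicalSpace.ofClosed {Z | IsZariskiClosed Z} isZariskiClosed_empty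
    (fun F hF => IsZariskiClosed.sInter F (fun _ hZ => hF hZ))
    (fun Y hY Z hZ => IsZariskiClosed.union Y Z hY hZ)

/-- The Zariski closure, in the space of all matrices, of a set of matrices. -/
def zariskiClosure {n : ℕ} (X : Set (Matrix (Fin n) (Fin n) ℂ)) :
    Set (Matrix (Fin n) (Fin n) ℂ) :=
  @closure _ (zariskiTopology n) X

/-- The dimension of a set of matrices, with the topology induced by the Zariski topology: the
supremum of the lengths of chains of irreducible closed subsets. -/
noncomputable def zariskiDim {n : ℕ} (V : Set (Matrix (Fin n) (Fin n) ℂ)) : WithBot ℕ∞ :=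
  @topologicalKrullDim V (TopologicalSpace.induced Subtype.val (zariskiTopology n))

/-- The number of irreducible components of a set of matrices, with the topology induced by the
Zariski topology. -/
noncomputable def numIrredComponents {n : ℕ} (V : Set (Matrix (Fin n) (Fin n) ℂ)) : ℕ∞ :=
  (@irreducibleComponents V (TopologicalSpace.induced Subtype.val (zariskiTopology n))).encard

/-- The cyclic group `⟨M⟩ = {M ^ k | k ∈ ℤ}`, as a set of matrices. -/
def cyclicMatrixGroup {n : ℕ} (M : GL (Fin n) ℂ) : Set (Matrix (Fin n) (Fin n) ℂ) :=
  {A | ∃ g ∈ Subgroup.zpowers M, A = (g : Matrix (Fin n) (Fin n) ℂ)}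

/-- `M = Ms * Mu` is the multiplicative Jordan decomposition of the invertible matrix `M`:
`Ms` is semisimple, `Mu` is unipotent, and they commute. -/
structure IsJordanDecomposition {n : ℕ} (M Ms Mu : GL (Fin n) ℂ) : Prop where
  eq_mul : M = Ms * Mu
  commute : Commute Ms Mu
  semisimple : Module.End.IsSemisimple (Matrix.toLin' (Ms : Matrix (Fin n) (Fin n) ℂ))
  unipotent : IsNilpotent ((Mu : Matrix (Fin n) (Fin n) ℂ) - 1)

/-!
The coordinate ring of the Zariski closure of `⟨M⟩` is the ring `R_M` of functions on `ℤ` of the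
form `k ↦ p (M ^ k)` with `p` a polynomial in the matrix entries. By the Nullstellensatz, the
dimension of the closure is the Krull dimension of `R_M`, and a set of matrices is irreducible if
and only if its vanishing ideal is prime.

Lagrange interpolation at the eigenvalues of `Ms` gives matrices `e i` that commute with `Mu`, with
`∑ i, e i = 1` and `Ms * e i = lam i • e i`, hence `M ^ k = ∑ i, lam i ^ k • (e i * Mu ^ k)`, where
the entries of `Mu ^ k` are polynomials in `k`. So every function in `R_M` is a quasi-polynomial, a
combination of the functions `k ↦ k ^ j * γ ^ k` with `γ` in the group `Γ` generated by the
`lam i`. These functions are linearly independent, as they lie in generalized eigenspaces of the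
shift operator (`eq_zero_of_sum_eval_mul_zpow_eq_zero`), so that the quasi-polynomials form a
polynomial ring over the group algebra of `Γ` (`quasiPolyHom_injective`). It is a domain if `Γ` is
torsion-free.

Conversely, multiplying `M ^ k` by the last, or the last but one, nonzero matrix
`e i * (Mu - 1) ^ m` shows that `R_M` contains each `k ↦ lam i ^ k`, and also `k ↦ lam i ^ k * k`
for some `i` if `Mu ≠ 1`. As `R_Ms` is generated by the functions `k ↦ lam i ^ k`, this gives
`R_Ms[a * t] ⊆ R_M ⊆ R_Ms[t]`, where `a` is one of these functions and `t` is the function `k ↦ k`,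
which is transcendental over `R_Ms`. If `Γ` is torsion-free, these are domains, the extension
`R_M ⊆ R_Ms[t]` is algebraic, and `dim R_M = dim R_Ms + 1` (`Subalgebra.ringKrullDim_eq_add_one`);
the case `M = Mu`, `Ms = 1` shows that the closure of `⟨Mu⟩` has dimension `1`.

In general, let `d` be the order of the torsion subgroup of `Γ`. The eigenvalues of `M ^ d` generate
a torsion-free group, and the closure of `⟨M⟩` is the union of the closures of the `d` cosets
`M ^ r * ⟨M ^ d⟩`. They are translates of one another, so that passing to `M ^ d` does not change
the dimension. They are irreducible, and a generator of the cyclic torsion subgroup of `Γ`, written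
as a quotient of two products of eigenvalues, separates them
(`IsSpectralResolution.eq_of_cosetClosure_subset`). Hence they are the irreducible components, and
there are `d` of them, a number that depends only on the eigenvalues and so is the same for `M` and
for `Ms` (`IsSpectralResolution.numIrredComponents_eq`).
-/

/-! ### Krull dimension of finitely generated domains -/

/-- Going up and incomparability: an injective integral extension preserves the Krull dimension. -/
theorem ringKrullDim_eq_of_isIntegral (R S : Type*) [CommRing R] [CommRing S] [Algebra R S]
    [FaithfulSMul R S] [Algebra.IsIntegral R S] :
    ringKrullDim S = ringKrullDim R := by
  refine le_antisymm ?_ ?_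
  · refine Order.krullDim_le_of_strictMono (PrimeSpectrum.comap (algebraMap R S)) ?_
    intro P Q hPQ
    exact Ideal.IsIntegral.comap_lt_comap (A := S) hPQ
  · refine iSup_le fun l => ?_
    obtain ⟨P, hP⟩ := Algebra.IsIntegral.comap_surjective R S l.head
    have : P.asIdeal.LiesOver l.head.asIdeal := ⟨by rw [← hP]; rfl⟩
    obtain ⟨L, hL, -⟩ := Ideal.exists_ltSeries_of_hasGoingUp l P.asIdeal
    rw [← hL]
    exact Order.LTSeries.length_le_krullDim L

/-- By Noether normalization, the Krull dimension of a finitely generated domain over a field is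
its transcendence degree. -/
theorem ringKrullDim_eq_and_trdeg_eq_of_finiteType (k R : Type*) [Field k] [CommRing R] [IsDomain R]
    [Algebra k R] [Algebra.FiniteType k R] :
    ∃ s : ℕ, ringKrullDim R = s ∧ Algebra.trdeg k R = s := by
  obtain ⟨s, g, hg, hint⟩ := exists_integral_inj_algHom_of_fg k R
  refine ⟨s, ?_⟩
  let _ : Algebra (MvPolynomial (Fin s) k) R := g.toRingHom.toAlgebra
  have : Algebra.IsIntegral (MvPolynomial (Fin s) k) R := ⟨hint⟩
  have : IsScalarTower k (MvPolynomial (Fin s) k) R := .of_algHom g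
  have hg' : Function.Injective (algebraMap (MvPolynomial (Fin s) k) R) := hg
  have : FaithfulSMul (MvPolynomial (Fin s) k) R :=
    (faithfulSMul_iff_algebraMap_injective _ _).mpr hg'
  refine ⟨?_, ?_⟩
  · rw [ringKrullDim_eq_of_isIntegral (MvPolynomial (Fin s) k) R]
    simp
  · have h := lift_trdeg_add_eq k (MvPolynomial (Fin s) k) R
    rw [trdeg_eq_zero (R := MvPolynomial (Fin s) k) (A := R)] at h
    simp only [MvPolynomial.trdeg_of_isDomain, Cardinal.mk_fin, Cardinal.lift_natCast,
      Cardinal.lift_zero, add_zero] at h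
    exact (Cardinal.lift_eq_nat_iff.mp h.symm)

/-- An algebraic extension of finitely generated domains over a field preserves the Krull
dimension. -/
theorem ringKrullDim_eq_of_isAlgebraic (k A B : Type*) [Field k] [CommRing A] [CommRing B]
    [IsDomain A] [IsDomain B] [Algebra k A] [Algebra k B] [Algebra A B] [IsScalarTower k A B]
    [Algebra.FiniteType k A] [Algebra.FiniteType k B] [FaithfulSMul A B]
    [Algebra.IsAlgebraic A B] : ringKrullDim A = ringKrullDim B := by
  obtain ⟨s, hs, hs'⟩ := ringKrullDim_eq_and_trdeg_eq_of_finiteType k A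
  obtain ⟨t, ht, ht'⟩ := ringKrullDim_eq_and_trdeg_eq_of_finiteType k B
  have h := lift_trdeg_add_eq k A B
  rw [trdeg_eq_zero (R := A) (A := B), hs', ht'] at h
  simp only [Cardinal.lift_natCast, Cardinal.lift_zero, add_zero, Nat.cast_inj] at h
  rw [hs, ht, h]

/-! ### Dimension and irreducible components of finite closed unions -/

section Topology

variable {X ι : Type*} [TopologicalSpace X]

open TopologicalSpace

theorem Topology.IsInducing.isPreirreducible_of_image {Y : Type*} [TopologicalSpace Y] {f : Y → X}
    (hf : Topology.IsInducing f) {s : Set Y} (hs : IsPreirreducible (f '' s)) :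
    IsPreirreducible s := by
  intro u v hu hv hsu hsv
  obtain ⟨u', hu', rfl⟩ := hf.isOpen_iff.mp hu
  obtain ⟨v', hv', rfl⟩ := hf.isOpen_iff.mp hv
  obtain ⟨x, hx, hxu⟩ := hsu
  obtain ⟨y, hy, hyv⟩ := hsv
  obtain ⟨_, ⟨z, hz, rfl⟩, hzuv⟩ :=
    hs u' v' hu' hv' ⟨f x, ⟨x, hx, rfl⟩, hxu⟩ ⟨f y, ⟨y, hy, rfl⟩, hyv⟩
  exact ⟨z, hz, hzuv⟩

theorem IsIrreducible.subtypeVal_preimage {V W : Set X} (hW : IsIrreducible W) (h : W ⊆ V) :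
    IsIrreducible ((↑) ⁻¹' W : Set V) := by
  have himage : ((↑) : V → X) '' ((↑) ⁻¹' W) = W := by
    rw [Subtype.image_preimage_coe, Set.inter_eq_right.mpr h]
  constructor
  · obtain ⟨x, hx⟩ := hW.nonempty
    exact ⟨⟨x, h hx⟩, hx⟩
  · exact Topology.IsInducing.subtypeVal.isPreirreducible_of_image
      (himage.symm ▸ hW.isPreirreducible)

/-- The dimension of a closed subspace, computed by chains of irreducible closed subsets of the
ambient space. -/
theorem IsClosed.topologicalKrullDim_eq {V : Set X} (hV : IsClosed V) :
    topologicalKrullDim V = Order.krullDim {W : IrreducibleCloseds X // (W : Set X) ⊆ V} := by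
  apply le_antisymm
  · refine Order.krullDim_le_of_strictMono
      (fun W => ⟨W.map Subtype.val continuous_subtype_val,
        closure_minimal (Subtype.coe_image_subset V W) hV⟩) ?_
    exact fun W W' h => IrreducibleCloseds.map_strictMono_of_isInducing .subtypeVal h
  · refine Order.krullDim_le_of_strictMono
      (fun W => ⟨(↑) ⁻¹' (W.1 : Set X), W.1.isIrreducible.subtypeVal_preimage W.2,
        W.1.isClosed.preimage continuous_subtype_val⟩) (Monotone.strictMono_of_injective ?_ ?_)
    · exact fun W W' h x hx => h hx
    · intro W W' h
      have h' : ((↑) : V → X) ⁻¹' (W.1 : Set X) = (↑) ⁻¹' (W'.1 : Set X) :=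
        congrArg (fun Z : IrreducibleCloseds V => (Z : Set V)) h
      rw [Subtype.preimage_val_eq_preimage_val_iff, Set.inter_eq_right.mpr W.2,
        Set.inter_eq_right.mpr W'.2] at h'
      exact Subtype.ext (IrreducibleCloseds.ext h')

theorem IsIrreducible.exists_subset_of_subset_iUnion [Finite ι] {V : ι → Set X}
    (hV : ∀ i, IsClosed (V i)) {W : Set X} (hW : IsIrreducible W) (h : W ⊆ ⋃ i, V i) :
    ∃ i, W ⊆ V i := by
  obtain ⟨_, hz, hWz⟩ := isIrreducible_iff_sUnion_isClosed.mp hW (Set.finite_range V).toFinset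
    (by simpa using hV) (by simpa using h)
  obtain ⟨i, rfl⟩ : ∃ i, V i = _ := by simpa using hz
  exact ⟨i, hWz⟩

theorem topologicalKrullDim_iUnion_le [Finite ι] {V : ι → Set X} (hV : ∀ i, IsClosed (V i))
    {d : WithBot ℕ∞} (hd : ∀ i, topologicalKrullDim (V i) ≤ d) :
    topologicalKrullDim (⋃ i, V i : Set X) ≤ d := by
  rw [(isClosed_iUnion_of_finite hV).topologicalKrullDim_eq]
  refine iSup_le fun l => ?_
  -- A chain lies in the piece that contains its largest member.
  obtain ⟨i, hi⟩ := l.last.1.isIrreducible.exists_subset_of_subset_iUnion hV l.last.2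
  refine le_trans ?_ (hd i)
  rw [(hV i).topologicalKrullDim_eq]
  let l' : LTSeries {W : IrreducibleCloseds X // (W : Set X) ⊆ V i} :=
    { length := l.length
      toFun := fun j => ⟨(l j).1, fun x hx => hi (LTSeries.monotone l (Fin.le_last j) hx)⟩
      step := fun j => l.step j }
  exact Order.LTSeries.length_le_krullDim l'

/-- An irredundant cover of a space by finitely many irreducible closed sets consists of the
irreducible components. -/
theorem irreducibleComponents_eq_range [Finite ι] {V : ι → Set X} (hV : ∀ i, IsClosed (V i))
    (hirr : ∀ i, IsIrreducible (V i)) (hinj : ∀ i j, V i ⊆ V j → i = j)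
    (hcover : ⋃ i, V i = Set.univ) : irreducibleComponents X = Set.range V := by
  ext s
  constructor
  · intro hs
    obtain ⟨i, hi⟩ := hs.prop.exists_subset_of_subset_iUnion hV (by simp [hcover])
    exact ⟨i, (hs.eq_of_subset (hirr i) hi).symm⟩
  · rintro ⟨i, rfl⟩
    refine ⟨hirr i, fun t ht hit => ?_⟩
    obtain ⟨j, hj⟩ := ht.exists_subset_of_subset_iUnion hV (by simp [hcover])
    obtain rfl := hinj i j (hit.trans hj)
    exact hj

theorem encard_irreducibleComponents_iUnion [Finite ι] {V : ι → Set X} (hV : ∀ i, IsClosed (V i))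
    (hirr : ∀ i, IsIrreducible (V i)) (hinj : ∀ i j, V i ⊆ V j → i = j) :
    (irreducibleComponents (⋃ i, V i : Set X)).encard = ENat.card ι := by
  have hinj' : ∀ i j, (((↑) : (⋃ i, V i : Set X) → X) ⁻¹' V i) ⊆ (↑) ⁻¹' V j → i = j :=
    fun i j h => hinj i j fun x hx => @h ⟨x, Set.mem_iUnion_of_mem i hx⟩ hx
  rw [irreducibleComponents_eq_range (V := fun i => ((↑) : (⋃ i, V i : Set X) → X) ⁻¹' V i)
    (fun i => (hV i).preimage continuous_subtype_val)
    (fun i => (hirr i).subtypeVal_preimage (Set.subset_iUnion V i)) hinj'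
    (by rw [← Set.preimage_iUnion]; exact Subtype.coe_preimage_self _), ← Set.image_univ,
    Function.Injective.encard_image (fun i j h => hinj' i j h.subset), Set.encard_univ]

end Topology

/-! ### The Zariski topology on matrices -/

section Zariski

variable {n : ℕ}

open TopologicalSpace

/-- The entries of a matrix, as a point of affine space. -/
def matrixEntries (A : Matrix (Fin n) (Fin n) ℂ) : Fin n × Fin n → ℂ := fun ij => A ij.1 ij.2

/-- The ideal of polynomials in the matrix entries that vanish on a set of matrices. -/
noncomputable def matrixVanishingIdeal (S : Set (Matrix (Fin n) (Fin n) ℂ)) :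
    Ideal (MvPolynomial (Fin n × Fin n) ℂ) :=
  MvPolynomial.vanishingIdeal ℂ (matrixEntries '' S)

/-- The set of matrices on which all polynomials of an ideal vanish. -/
def matrixZeroLocus (I : Ideal (MvPolynomial (Fin n × Fin n) ℂ)) :
    Set (Matrix (Fin n) (Fin n) ℂ) :=
  {A | ∀ p ∈ I, MvPolynomial.eval (matrixEntries A) p = 0}

theorem mem_matrixVanishingIdeal {S : Set (Matrix (Fin n) (Fin n) ℂ)}
    {p : MvPolynomial (Fin n × Fin n) ℂ} :
    p ∈ matrixVanishingIdeal S ↔ ∀ A ∈ S, MvPolynomial.eval (matrixEntries A) p = 0 := by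
  simp [matrixVanishingIdeal, MvPolynomial.aeval_eq_eval]

theorem matrixVanishingIdeal_matrixZeroLocus (P : Ideal (MvPolynomial (Fin n × Fin n) ℂ))
    [P.IsPrime] : matrixVanishingIdeal (matrixZeroLocus P) = P := by
  have h : matrixEntries '' matrixZeroLocus P = MvPolynomial.zeroLocus ℂ P := by
    ext x
    constructor
    · rintro ⟨A, hA, rfl⟩ p hp
      exact hA p hp
    · intro hx
      exact ⟨fun i j => x (i, j), hx, rfl⟩
  rw [matrixVanishingIdeal, h, MvPolynomial.IsPrime.vanishingIdeal_zeroLocus]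

theorem isZariskiClosed_matrixZeroLocus (I : Ideal (MvPolynomial (Fin n × Fin n) ℂ)) :
    IsZariskiClosed (matrixZeroLocus I) :=
  ⟨I, rfl⟩

theorem subset_matrixZeroLocus_iff {S : Set (Matrix (Fin n) (Fin n) ℂ)}
    {I : Ideal (MvPolynomial (Fin n × Fin n) ℂ)} :
    S ⊆ matrixZeroLocus I ↔ I ≤ matrixVanishingIdeal S :=
  ⟨fun h _ hp => mem_matrixVanishingIdeal.mpr fun _ hA => h hA _ hp,
    fun h A hA _ hp => mem_matrixVanishingIdeal.mp (h hp) A hA⟩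

theorem IsZariskiClosed.matrixZeroLocus_matrixVanishingIdeal {Z : Set (Matrix (Fin n) (Fin n) ℂ)}
    (hZ : IsZariskiClosed Z) : matrixZeroLocus (matrixVanishingIdeal Z) = Z := by
  refine Set.Subset.antisymm ?_ (subset_matrixZeroLocus_iff.mpr le_rfl)
  obtain ⟨T, rfl⟩ := hZ
  exact fun A hA p hp => hA p (mem_matrixVanishingIdeal.mpr fun B hB => hB p hp)

theorem isClosed_zariskiTopology_iff {Z : Set (Matrix (Fin n) (Fin n) ℂ)} :
    @IsClosed _ (zariskiTopology n) Z ↔ IsZariskiClosed Z := by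
  rw [← @isOpen_compl_iff _ _ (zariskiTopology n)]
  change Zᶜᶜ ∈ {Z | IsZariskiClosed Z} ↔ _
  rw [compl_compl, Set.mem_ofPred_eq]

theorem zariskiClosure_eq (S : Set (Matrix (Fin n) (Fin n) ℂ)) :
    zariskiClosure S = matrixZeroLocus (matrixVanishingIdeal S) := by
  -- The local instance takes precedence over the Euclidean topology of matrices.
  let := zariskiTopology n
  change closure S = _
  have h : IsZariskiClosed (closure S) := isClosed_zariskiTopology_iff.mp isClosed_closure
  apply Set.Subset.antisymm
  · exact closure_minimal (subset_matrixZeroLocus_iff.mpr le_rfl)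
      (isClosed_zariskiTopology_iff.mpr (isZariskiClosed_matrixZeroLocus _))
  · rw [← h.matrixZeroLocus_matrixVanishingIdeal]
    exact fun A hA p hp => hA p (mem_matrixVanishingIdeal.mpr fun B hB =>
      mem_matrixVanishingIdeal.mp hp B (subset_closure hB))

theorem isIrreducible_zariski_iff {S : Set (Matrix (Fin n) (Fin n) ℂ)} :
    @IsIrreducible _ (zariskiTopology n) S ↔ (matrixVanishingIdeal S).IsPrime := by
  let := zariskiTopology n
  constructor
  · intro h
    refine ⟨fun h1 => ?_, fun {p q} hpq => ?_⟩
    · obtain ⟨A, hA⟩ := h.nonempty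
      have h0 := mem_matrixVanishingIdeal.mp ((Ideal.eq_top_iff_one _).mp h1) A hA
      simp at h0
    · have hcover : S ⊆ matrixZeroLocus (Ideal.span {p}) ∪ matrixZeroLocus (Ideal.span {q}) := by
        intro A hA
        have h0 := mem_matrixVanishingIdeal.mp hpq A hA
        rw [map_mul, mul_eq_zero] at h0
        refine h0.imp (fun h r hr => ?_) fun h r hr => ?_ <;>
        · obtain ⟨s, rfl⟩ := Ideal.mem_span_singleton.mp hr
          rw [map_mul, h, zero_mul]
      refine (isPreirreducible_iff_isClosed_union_isClosed.mp h.isPreirreducible _ _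
        (isClosed_zariskiTopology_iff.mpr (isZariskiClosed_matrixZeroLocus _))
        (isClosed_zariskiTopology_iff.mpr (isZariskiClosed_matrixZeroLocus _)) hcover).imp ?_ ?_ <;>
      · rw [subset_matrixZeroLocus_iff, Ideal.span_singleton_le_iff_mem]
        exact id
  · intro h
    constructor
    · rw [Set.nonempty_iff_ne_empty]
      rintro rfl
      exact h.ne_top (Ideal.eq_top_iff_one _ |>.mpr (mem_matrixVanishingIdeal.mpr (by simp)))
    · refine isPreirreducible_iff_isClosed_union_isClosed.mpr fun Y Z hY hZ hS => ?_
      replace hY := isClosed_zariskiTopology_iff.mp hY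
      replace hZ := isClosed_zariskiTopology_iff.mp hZ
      rw [← hY.matrixZeroLocus_matrixVanishingIdeal, ← hZ.matrixZeroLocus_matrixVanishingIdeal,
        subset_matrixZeroLocus_iff, subset_matrixZeroLocus_iff]
      apply h.mul_le.mp
      rw [Ideal.mul_le]
      intro p hp q hq
      refine mem_matrixVanishingIdeal.mpr fun A hA => ?_
      rw [map_mul, mul_eq_zero]
      exact (hS hA).imp (mem_matrixVanishingIdeal.mp hp A) (mem_matrixVanishingIdeal.mp hq A)

/-- By the Nullstellensatz, irreducible closed subsets of the closure of `S` correspond to prime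
ideals of the coordinate ring. -/
theorem zariskiDim_zariskiClosure (S : Set (Matrix (Fin n) (Fin n) ℂ)) :
    zariskiDim (zariskiClosure S) =
      ringKrullDim (MvPolynomial (Fin n × Fin n) ℂ ⧸ matrixVanishingIdeal S) := by
  let := zariskiTopology n
  rw [ringKrullDim_quotient, ← Order.krullDim_orderDual]
  refine (IsClosed.topologicalKrullDim_eq (isClosed_closure (s := S))).trans
    (Order.krullDim_eq_of_orderIso ?_)
  refine Equiv.toOrderIso
    { toFun := fun W => OrderDual.toDual
        ⟨⟨matrixVanishingIdeal W.1, isIrreducible_zariski_iff.mp W.1.isIrreducible⟩, ?_⟩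
      invFun := fun P => ⟨⟨matrixZeroLocus (OrderDual.ofDual P).1.asIdeal, ?_, ?_⟩, ?_⟩
      left_inv := ?_
      right_inv := ?_ } ?_ ?_
  · intro p hp
    refine mem_matrixVanishingIdeal.mpr fun A hA => ?_
    have h : A ∈ zariskiClosure S := W.2 hA
    rw [zariskiClosure_eq] at h
    exact h p hp
  · rw [isIrreducible_zariski_iff, matrixVanishingIdeal_matrixZeroLocus]
    infer_instance
  · exact isClosed_zariskiTopology_iff.mpr (isZariskiClosed_matrixZeroLocus _)
  · intro A hA
    change A ∈ zariskiClosure S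
    rw [zariskiClosure_eq]
    exact fun p hp => hA p ((OrderDual.ofDual P).2 hp)
  · intro W
    exact Subtype.ext (IrreducibleCloseds.ext
      (isClosed_zariskiTopology_iff.mp W.1.isClosed).matrixZeroLocus_matrixVanishingIdeal)
  · intro P
    exact congrArg OrderDual.toDual (Subtype.ext (PrimeSpectrum.ext
      (matrixVanishingIdeal_matrixZeroLocus (OrderDual.ofDual P).1.asIdeal)))
  · intro W W' h p hp
    exact mem_matrixVanishingIdeal.mpr fun A hA => mem_matrixVanishingIdeal.mp hp A (h hA)
  · intro P P' h A hA p hp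
    exact hA p (h hp)

end Zariski

/-! ### Quasi-polynomials -/

section QuasiPolynomial

open Polynomial

/-- The shift operator minus `γ` acts on functions `k ↦ g k * γ ^ k` as `γ` times the forward
difference of `g`, and iterated forward differences annihilate polynomials. -/
theorem eval_mul_zpow_mem_maxGenEigenspace (γ : ℂˣ) (p : ℂ[X]) :
    (fun k : ℤ => p.eval (k : ℂ) * ((γ ^ k : ℂˣ) : ℂ)) ∈
      Module.End.maxGenEigenspace (LinearMap.funLeft ℂ ℂ (fun k : ℤ => k + 1)) (γ : ℂ) := by
  have key (g : ℂ → ℂ) (m : ℕ) (k : ℤ) :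
      (((LinearMap.funLeft ℂ ℂ (fun k : ℤ => k + 1)) - (γ : ℂ) • (1 : Module.End ℂ (ℤ → ℂ))) ^ m)
        (fun k : ℤ => g k * ((γ ^ k : ℂˣ) : ℂ)) k =
      (fwdDiff 1)^[m] g k * ((γ ^ (k + m) : ℂˣ) : ℂ) := by
    induction m generalizing g with
    | zero => simp
    | succ m ih =>
      have hstep : ((LinearMap.funLeft ℂ ℂ (fun k : ℤ => k + 1)) -
          (γ : ℂ) • (1 : Module.End ℂ (ℤ → ℂ))) (fun k : ℤ => g k * ((γ ^ k : ℂˣ) : ℂ)) =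
          (γ : ℂ) • fun k : ℤ => fwdDiff 1 g k * ((γ ^ k : ℂˣ) : ℂ) := by
        ext k
        simp only [LinearMap.sub_apply, LinearMap.smul_apply, Module.End.one_apply, Pi.sub_apply,
          LinearMap.funLeft_apply, Pi.smul_apply, smul_eq_mul, fwdDiff, zpow_add_one, Units.val_mul,
          Int.cast_add, Int.cast_one]
        ring
      rw [pow_succ, Module.End.mul_apply, hstep, map_smul, Pi.smul_apply, ih,
        Function.iterate_succ_apply, Nat.cast_succ, ← add_assoc, zpow_add_one, Units.val_mul,
        smul_eq_mul]
      ring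
  rw [Module.End.mem_maxGenEigenspace]
  refine ⟨p.natDegree + 1, funext fun k => ?_⟩
  rw [key (fun x => p.eval x), p.fwdDiff_iter_degree_add_one_eq_zero]
  simp

/-- Generalized eigenspaces of the shift operator are independent, so a vanishing quasi-polynomial
`k ↦ ∑ i, p i k * u i ^ k` with distinct frequencies `u i` has vanishing coefficients `p i`. -/
theorem eq_zero_of_sum_eval_mul_zpow_eq_zero {ι : Type*} {u : ι → ℂˣ} (hu : Function.Injective u)
    (s : Finset ι) (p : ι → ℂ[X])
    (h : ∀ k : ℤ, ∑ i ∈ s, (p i).eval (k : ℂ) * ((u i ^ k : ℂˣ) : ℂ) = 0) :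
    ∀ i ∈ s, p i = 0 := by
  intro i hi
  have hind := (Module.End.independent_maxGenEigenspace
    (LinearMap.funLeft ℂ ℂ (fun k : ℤ => k + 1))).comp (Units.val_injective.comp hu)
  have h0 := (iSupIndep_iff_finsetSum_eq_zero_imp_eq_zero _).mp hind s
    (fun i k => (p i).eval (k : ℂ) * ((u i ^ k : ℂˣ) : ℂ))
    (fun i _ => eval_mul_zpow_mem_maxGenEigenspace (u i) (p i)) (by
      ext k
      simpa using h k) i hi
  refine Polynomial.eq_zero_of_infinite_isRoot _
    ((Set.infinite_range_of_injective (Int.cast_injective (α := ℂ))).mono ?_)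
  rintro _ ⟨k, rfl⟩
  exact (mul_eq_zero.mp (congrFun h0 k)).resolve_right (Units.ne_zero _)

variable (Γ : Subgroup ℂˣ)

/-- Evaluation at `k : ℤ` of a quasi-polynomial with frequencies in `Γ`. A quasi-polynomial is
encoded as a polynomial over the group algebra of `Γ`: the variable stands for the function
`k ↦ k`, and the group element `γ` for the function `k ↦ γ ^ k`. -/
noncomputable def quasiPolyEval (k : ℤ) : (MonoidAlgebra ℂ Γ)[X] →ₐ[ℂ] ℂ :=
  Polynomial.eval₂AlgHom (MonoidAlgebra.lift ℂ ℂ Γ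
    ((Units.coeHom ℂ).comp ((zpowGroupHom k).comp Γ.subtype))) (k : ℂ) (fun _ => Commute.all _ _)

@[simp]
theorem quasiPolyEval_X (k : ℤ) : quasiPolyEval Γ k X = k := by
  simp [quasiPolyEval]

theorem quasiPolyEval_C (k : ℤ) (f : MonoidAlgebra ℂ Γ) :
    quasiPolyEval Γ k (C f) = MonoidAlgebra.lift ℂ ℂ Γ
      ((Units.coeHom ℂ).comp ((zpowGroupHom k).comp Γ.subtype)) f := by
  simp [quasiPolyEval]

@[simp]
theorem quasiPolyEval_single (k : ℤ) (γ : Γ) (c : ℂ) :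
    quasiPolyEval Γ k (C (MonoidAlgebra.single γ c)) = c * ((γ : ℂˣ) ^ k : ℂˣ) := by
  simp [quasiPolyEval]

theorem quasiPolyEval_injective {P : (MonoidAlgebra ℂ Γ)[X]} (h : ∀ k, quasiPolyEval Γ k P = 0) :
    P = 0 := by
  classical
  -- Collect the terms of each frequency `γ` into one polynomial `p γ`.
  let s : Finset Γ := P.support.biUnion fun j => (P.coeff j).coeff.support
  let p : Γ → ℂ[X] := fun γ => ∑ j ∈ P.support, monomial j ((P.coeff j).coeff γ)
  have hp : ∀ γ ∈ s, p γ = 0 := by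
    refine eq_zero_of_sum_eval_mul_zpow_eq_zero (u := ((↑) : Γ → ℂˣ)) Subtype.val_injective s p
      fun k => ?_
    rw [← h k, P.as_sum_support, map_sum]
    simp only [p, eval_finsetSum, eval_monomial, Finset.sum_mul]
    rw [Finset.sum_comm]
    refine Finset.sum_congr rfl fun j hj => ?_
    rw [← C_mul_X_pow_eq_monomial, map_mul, map_pow, quasiPolyEval_X, quasiPolyEval_C,
      MonoidAlgebra.lift_apply, Finsupp.sum_of_support_subset _
        (Finset.subset_biUnion_of_mem (fun j => (P.coeff j).coeff.support) hj) _ (by simp),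
      Finset.sum_mul]
    refine Finset.sum_congr rfl fun γ _ => ?_
    simp
    ring
  ext j γ
  by_cases hj : j ∈ P.support
  · by_cases hγ : γ ∈ s
    · simpa [p, finsetSum_coeff, coeff_monomial, hj] using congrArg (coeff · j) (hp γ hγ)
    · by_contra hne
      exact hγ (Finset.mem_biUnion.mpr ⟨j, hj, by simpa using hne⟩)
  · simp [notMem_support_iff.mp hj]

instance [Group.FG Γ] [IsMulTorsionFree Γ] : IsDomain (MonoidAlgebra ℂ Γ) := by
  have : Monoid.FG Γ := Group.fg_iff_monoid_fg.mp inferInstance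
  infer_instance

end QuasiPolynomial

/-! ### Spectral resolutions and powers of matrices -/

section Spectral

open Polynomial

/-- The polynomial whose value at `k` is the binomial coefficient `k.choose j`. -/
noncomputable def binomialPolynomial (j : ℕ) : ℂ[X] := C ((j.factorial : ℂ)⁻¹) * descPochhammer ℂ j

/-- Pascal's rule. -/
theorem eval_binomialPolynomial_succ (j : ℕ) (x : ℂ) :
    (binomialPolynomial (j + 1)).eval (x + 1) =
      (binomialPolynomial (j + 1)).eval x + (binomialPolynomial j).eval x := by
  have h := congrArg (eval (x + 1)) (descPochhammer_succ_comp_X_sub_one (R := ℂ) j)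
  simp only [smul_eq_mul, eval_mul, eval_add, eval_natCast, eval_comp, eval_sub, eval_X, eval_one,
    add_sub_cancel_right] at h
  simp only [binomialPolynomial, eval_mul, eval_C, h, Nat.factorial_succ]
  have h1 : (j.factorial : ℂ) ≠ 0 := by exact_mod_cast j.factorial_ne_zero
  have h2 : (j + 1 : ℂ) ≠ 0 := by exact_mod_cast j.succ_ne_zero
  push_cast
  field_simp
  ring

theorem eval_binomialPolynomial_zero (j : ℕ) :
    (binomialPolynomial j).eval 0 = if j = 0 then 1 else 0 := by
  cases j with
  | zero => simp [binomialPolynomial]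
  | succ j => simp [binomialPolynomial, descPochhammer_succ_left]

variable {n : ℕ}

/-- A two-sided sequence of matrices in which each term is the previous one times `U` is
determined by its term at `0`. -/
theorem eq_mul_zpow_of_succ {U : GL (Fin n) ℂ} {f : ℤ → Matrix (Fin n) (Fin n) ℂ}
    (hf : ∀ k, f (k + 1) = f k * (U : Matrix (Fin n) (Fin n) ℂ)) (k : ℤ) :
    f k = f 0 * ((U ^ k : GL (Fin n) ℂ) : Matrix (Fin n) (Fin n) ℂ) := by
  induction k with
  | zero => simp
  | succ k ih => rw [hf, ih, zpow_add_one, Units.val_mul, mul_assoc]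
  | pred k ih =>
    have h := hf (-(k : ℤ) - 1)
    rw [sub_add_cancel, ih] at h
    rw [zpow_sub_one, Units.val_mul, ← mul_assoc, h, mul_assoc, Units.mul_inv, mul_one]

/-- The integer powers of a unipotent matrix are given by the binomial formula. -/
theorem zpow_eq_sum_binomialPolynomial {U : GL (Fin n) ℂ} {l : ℕ}
    (hl : ((U : Matrix (Fin n) (Fin n) ℂ) - 1) ^ l = 0) (k : ℤ) :
    ((U ^ k : GL (Fin n) ℂ) : Matrix (Fin n) (Fin n) ℂ) =
      ∑ j ∈ Finset.range (l + 1),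
        (binomialPolynomial j).eval (k : ℂ) • ((U : Matrix (Fin n) (Fin n) ℂ) - 1) ^ j := by
  set N := (U : Matrix (Fin n) (Fin n) ℂ) - 1 with hN
  have hU : (U : Matrix (Fin n) (Fin n) ℂ) = 1 + N := by rw [hN]; abel
  have h := eq_mul_zpow_of_succ (U := U) (f := fun k => ∑ j ∈ Finset.range (l + 1),
    (binomialPolynomial j).eval (k : ℂ) • N ^ j) (fun k => ?_) k
  · rw [h]
    simp [eval_binomialPolynomial_zero]
  · have hmul : (∑ j ∈ Finset.range (l + 1), (binomialPolynomial j).eval (k : ℂ) • N ^ j) * N =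
        ∑ j ∈ Finset.range l, (binomialPolynomial j).eval (k : ℂ) • N ^ (j + 1) := by
      rw [Finset.sum_mul, Finset.sum_range_succ, smul_mul_assoc, hl, zero_mul, smul_zero, add_zero]
      simp only [smul_mul_assoc, ← pow_succ]
    rw [hU, mul_add, mul_one, hmul, Finset.sum_range_succ', Finset.sum_range_succ']
    simp only [Int.cast_add, Int.cast_one, eval_binomialPolynomial_succ, add_smul,
      Finset.sum_add_distrib]
    simp [binomialPolynomial]
    abel

theorem mul_zpow_eq_add_smul {U : GL (Fin n) ℂ} {E : Matrix (Fin n) (Fin n) ℂ}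
    (hE : E * ((U : Matrix (Fin n) (Fin n) ℂ) - 1) * ((U : Matrix (Fin n) (Fin n) ℂ) - 1) = 0)
    (k : ℤ) : E * ((U ^ k : GL (Fin n) ℂ) : Matrix (Fin n) (Fin n) ℂ) =
      E + (k : ℂ) • (E * ((U : Matrix (Fin n) (Fin n) ℂ) - 1)) := by
  set N := (U : Matrix (Fin n) (Fin n) ℂ) - 1 with hN
  have hU : (U : Matrix (Fin n) (Fin n) ℂ) = 1 + N := by rw [hN]; abel
  have h := eq_mul_zpow_of_succ (U := U) (f := fun k => E + (k : ℂ) • (E * N)) (fun k => ?_) k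
  · rw [h]
    simp
  · rw [hU, mul_add, mul_one, add_mul, smul_mul_assoc, hE]
    push_cast
    rw [smul_zero, add_smul, one_smul]
    abel

/-- A resolution of the identity `1 = ∑ i, e i` that commutes with the unipotent matrix `U` and on
whose `i`-th piece `M` acts as `lam i • U`. The scalars `lam i` are the eigenvalues of `M`; they
are not required to be distinct. -/
structure IsSpectralResolution {ι : Type*} [Fintype ι] (M U : GL (Fin n) ℂ) (lam : ι → ℂˣ)
    (e : ι → Matrix (Fin n) (Fin n) ℂ) : Prop where
  sum_eq_one : ∑ i, e i = 1
  ne_zero : ∀ i, e i ≠ 0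
  mul_eq : ∀ i, (M : Matrix (Fin n) (Fin n) ℂ) * e i =
    e i * ((lam i : ℂ) • (U : Matrix (Fin n) (Fin n) ℂ))
  commute : ∀ i, Commute (e i) (U : Matrix (Fin n) (Fin n) ℂ)
  unipotent : IsNilpotent ((U : Matrix (Fin n) (Fin n) ℂ) - 1)

namespace IsSpectralResolution

variable {ι : Type*} [Fintype ι] {M U : GL (Fin n) ℂ} {lam : ι → ℂˣ}
  {e : ι → Matrix (Fin n) (Fin n) ℂ}

theorem zpow_mul (h : IsSpectralResolution M U lam e) (k : ℤ) (i : ι) :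
    ((M ^ k : GL (Fin n) ℂ) : Matrix (Fin n) (Fin n) ℂ) * e i =
      e i * (((lam i ^ k : ℂˣ) : ℂ) • ((U ^ k : GL (Fin n) ℂ) : Matrix (Fin n) (Fin n) ℂ)) := by
  let c : GL (Fin n) ℂ := Units.map (algebraMap ℂ (Matrix (Fin n) (Fin n) ℂ)).toMonoidHom (lam i)
  have hc : Commute c U := Units.ext (Algebra.commutes _ _)
  have hs : SemiconjBy (e i) ((c * U : GL (Fin n) ℂ) : Matrix (Fin n) (Fin n) ℂ)
      (M : Matrix (Fin n) (Fin n) ℂ) := by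
    rw [SemiconjBy, h.mul_eq i, Units.val_mul, Algebra.smul_def]
    rfl
  have hk := hs.units_zpow_right k
  rw [SemiconjBy, hc.mul_zpow, ← map_zpow, Units.val_mul] at hk
  rw [← hk, Algebra.smul_def]
  rfl

theorem zpow_eq (h : IsSpectralResolution M U lam e) (k : ℤ) :
    ((M ^ k : GL (Fin n) ℂ) : Matrix (Fin n) (Fin n) ℂ) =
      ∑ i, ((lam i ^ k : ℂˣ) : ℂ) •
        (e i * ((U ^ k : GL (Fin n) ℂ) : Matrix (Fin n) (Fin n) ℂ)) := by
  rw [← mul_one ((M ^ k : GL (Fin n) ℂ) : Matrix (Fin n) (Fin n) ℂ), ← h.sum_eq_one,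
    Finset.mul_sum]
  simp only [h.zpow_mul, mul_smul_comm]

theorem pow (h : IsSpectralResolution M U lam e) (d : ℕ) :
    IsSpectralResolution (M ^ d) (U ^ d) (fun i => lam i ^ d) e where
  sum_eq_one := h.sum_eq_one
  ne_zero := h.ne_zero
  mul_eq i := by simpa using h.zpow_mul d i
  commute i := by simpa using (h.commute i).pow_right d
  unipotent := by
    rw [Units.val_pow_eq_pow_val, ← mul_geom_sum]
    exact Commute.isNilpotent_mul_right (Commute.sum_right _ _ _ fun j _ =>
      ((Commute.refl _).sub_left (Commute.one_left _)).pow_right j) h.unipotent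

theorem zpow_mul_mul_pow (h : IsSpectralResolution M U lam e) (k : ℤ) (i : ι) (m : ℕ) :
    ((M ^ k : GL (Fin n) ℂ) : Matrix (Fin n) (Fin n) ℂ) *
        (e i * ((U : Matrix (Fin n) (Fin n) ℂ) - 1) ^ m) =
      ((lam i ^ k : ℂˣ) : ℂ) • (e i * ((U : Matrix (Fin n) (Fin n) ℂ) - 1) ^ m *
        ((U ^ k : GL (Fin n) ℂ) : Matrix (Fin n) (Fin n) ℂ)) := by
  have hc : Commute (((U : Matrix (Fin n) (Fin n) ℂ) - 1) ^ m)
      ((U ^ k : GL (Fin n) ℂ) : Matrix (Fin n) (Fin n) ℂ) :=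
    (((Commute.refl _).sub_left (Commute.one_left _)).pow_left m).units_zpow_right k
  rw [← mul_assoc, h.zpow_mul, mul_assoc (e i), smul_mul_assoc, ← hc.eq, mul_smul_comm, mul_assoc]

/-- Each piece contains a nonzero matrix fixed by multiplication by `U`, namely the last nonzero
`e i * (U - 1) ^ m`. -/
theorem exists_zpow_mul_eq_smul (h : IsSpectralResolution M U lam e) (i : ι) :
    ∃ E : Matrix (Fin n) (Fin n) ℂ, E ≠ 0 ∧ ∀ k : ℤ,
      ((M ^ k : GL (Fin n) ℂ) : Matrix (Fin n) (Fin n) ℂ) * E = ((lam i ^ k : ℂˣ) : ℂ) • E := by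
  classical
  have hex : ∃ m, e i * ((U : Matrix (Fin n) (Fin n) ℂ) - 1) ^ m = 0 :=
    h.unipotent.imp fun m hm => by rw [hm, mul_zero]
  obtain ⟨m, hm⟩ : ∃ m, Nat.find hex = m + 1 :=
    Nat.exists_eq_succ_of_ne_zero fun h0 => h.ne_zero i (by simpa [h0] using Nat.find_spec hex)
  have hspec := Nat.find_spec hex
  rw [hm, pow_succ, ← mul_assoc] at hspec
  refine ⟨e i * ((U : Matrix (Fin n) (Fin n) ℂ) - 1) ^ m, Nat.find_min hex (by lia), fun k => ?_⟩
  rw [h.zpow_mul_mul_pow, mul_zpow_eq_add_smul (by rw [hspec, zero_mul]), hspec, smul_zero,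
    add_zero]

/-- If `U ≠ 1`, then some piece contains a matrix on which the powers of `U` act by a nonconstant
affine function of the exponent, namely the last but one nonzero `e i * (U - 1) ^ m`. -/
theorem exists_zpow_mul_eq_smul_add (h : IsSpectralResolution M U lam e) (hU : U ≠ 1) :
    ∃ i, ∃ E F : Matrix (Fin n) (Fin n) ℂ, F ≠ 0 ∧
      (∀ k : ℤ, E * ((U ^ k : GL (Fin n) ℂ) : Matrix (Fin n) (Fin n) ℂ) = E + (k : ℂ) • F) ∧
      ∀ k : ℤ, ((M ^ k : GL (Fin n) ℂ) : Matrix (Fin n) (Fin n) ℂ) * E =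
        ((lam i ^ k : ℂˣ) : ℂ) • (E + (k : ℂ) • F) := by
  classical
  obtain ⟨i, hi⟩ : ∃ i, e i * ((U : Matrix (Fin n) (Fin n) ℂ) - 1) ≠ 0 := by
    by_contra! hcon
    apply hU
    have h0 : (∑ i, e i) * ((U : Matrix (Fin n) (Fin n) ℂ) - 1) = 0 := by
      rw [Finset.sum_mul]
      exact Finset.sum_eq_zero fun i _ => hcon i
    rw [h.sum_eq_one, one_mul, sub_eq_zero] at h0
    exact Units.ext h0
  have hex : ∃ m, e i * ((U : Matrix (Fin n) (Fin n) ℂ) - 1) ^ m = 0 :=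
    h.unipotent.imp fun m hm => by rw [hm, mul_zero]
  obtain ⟨m, hm⟩ : ∃ m, Nat.find hex = m + 2 := by
    have h0 : Nat.find hex ≠ 0 := fun h0 => h.ne_zero i (by simpa [h0] using Nat.find_spec hex)
    have h1 : Nat.find hex ≠ 1 := fun h1 => hi (by simpa [h1] using Nat.find_spec hex)
    exact ⟨Nat.find hex - 2, by lia⟩
  have hspec := Nat.find_spec hex
  rw [hm, pow_succ, pow_succ, ← mul_assoc, ← mul_assoc] at hspec
  have hne := Nat.find_min hex (show m + 1 < Nat.find hex by lia)
  rw [pow_succ, ← mul_assoc] at hne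
  have hact := mul_zpow_eq_add_smul hspec
  exact ⟨i, _, _, hne, hact, fun k => by rw [h.zpow_mul_mul_pow, hact]⟩

theorem pow_ne_one (h : IsSpectralResolution M U lam e) (hU : U ≠ 1) {d : ℕ} (hd : d ≠ 0) :
    U ^ d ≠ 1 := by
  obtain ⟨i, E, F, hF, hE, -⟩ := h.exists_zpow_mul_eq_smul_add hU
  intro h1
  have h2 := hE d
  rw [zpow_natCast, h1, Units.val_one, mul_one, left_eq_add, smul_eq_zero] at h2
  exact h2.elim (by simpa using hd) hF

end IsSpectralResolution

/-- A Jordan decomposition gives a spectral resolution: the pieces are the values at the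
semisimple part of the Lagrange basis polynomials for the nodes at its eigenvalues. -/
theorem IsJordanDecomposition.exists_isSpectralResolution {M Ms Mu : GL (Fin n) ℂ}
    (h : IsJordanDecomposition M Ms Mu) :
    ∃ (ι : Type) (_ : Fintype ι) (lam : ι → ℂˣ) (e : ι → Matrix (Fin n) (Fin n) ℂ),
      IsSpectralResolution M Mu lam e ∧ IsSpectralResolution Ms 1 lam e := by
  classical
  set A : Matrix (Fin n) (Fin n) ℂ := (Ms : Matrix (Fin n) (Fin n) ℂ) with hA
  set q := minpoly ℂ A with hq
  have hmonic : q.Monic := minpoly.monic (Matrix.isIntegral A)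
  have hsq : Squarefree q := by
    rw [hq, ← Matrix.minpoly_toLin']
    exact h.semisimple.minpoly_squarefree
  have hnodup : q.roots.Nodup := nodup_roots (PerfectField.separable_iff_squarefree.mpr hsq)
  set s : Finset ℂ := q.roots.toFinset with hs
  have hnodal : Lagrange.nodal s id = q := by
    rw [(IsAlgClosed.splits q).eq_prod_roots_of_monic hmonic, Lagrange.nodal_eq,
      Finset.prod_multiset_map_count]
    refine Finset.prod_congr rfl fun a ha => ?_
    rw [Multiset.count_eq_one_of_mem hnodup (Multiset.mem_toFinset.mp ha), pow_one, id]
  have hroot (a : s) : aeval A (Lagrange.basis s id (a : ℂ)) ≠ 0 := by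
    intro h0
    obtain ⟨r, hr⟩ := minpoly.dvd ℂ A h0
    have h1 : (minpoly ℂ A).eval (a : ℂ) = 0 := by
      rw [← hq, ← hnodal]
      exact Lagrange.eval_nodal_at_node (v := (id : ℂ → ℂ)) a.2
    have h2 := Lagrange.eval_basis_self (v := (id : ℂ → ℂ)) (s := s) Function.injective_id.injOn a.2
    rw [hr] at h2
    simp [h1] at h2
  have hmul (a : s) : A * aeval A (Lagrange.basis s id (a : ℂ)) =
      (a : ℂ) • aeval A (Lagrange.basis s id (a : ℂ)) := by
    have h0 : (X - C (a : ℂ)) * Lagrange.basis s id (a : ℂ) =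
        C (Lagrange.nodalWeight s id (a : ℂ)) * q := by
      rw [Lagrange.basis_eq_prod_sub_inv_mul_nodal_div a.2, ← Lagrange.nodal_erase_eq_nodal_div a.2,
        mul_left_comm, ← hnodal, Lagrange.nodal_eq_mul_nodal_erase a.2]
      rfl
    have h1 := congrArg (aeval A) h0
    rw [map_mul, map_mul, hq, minpoly.aeval, mul_zero, map_sub, aeval_X, aeval_C, sub_mul,
      sub_eq_zero, ← Algebra.smul_def] at h1
    exact h1
  have hne (a : s) : (a : ℂ) ≠ 0 := by
    intro h0
    have h1 := hmul a
    rw [congrArg (· • aeval A (Lagrange.basis s id (a : ℂ))) h0, zero_smul] at h1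
    exact hroot a ((Units.mul_right_eq_zero Ms).mp h1)
  have hsum : ∑ a : s, aeval A (Lagrange.basis s id (a : ℂ)) = 1 := by
    rw [← map_sum, Finset.sum_coe_sort s fun a => Lagrange.basis s id a]
    rcases s.eq_empty_or_nonempty with h0 | h0
    -- No eigenvalue: the minimal polynomial is `1` and the matrices have size zero.
    · have h1 := minpoly.aeval ℂ A
      rw [← hq, ← hnodal, h0, Lagrange.nodal_empty, map_one] at h1
      rw [h0, Finset.sum_empty, map_zero, h1]
    · have h1 := Lagrange.sum_basis (v := (id : ℂ → ℂ)) Function.injective_id.injOn h0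
      rw [h1, map_one]
  have hcomm (a : s) : Commute (aeval A (Lagrange.basis s id (a : ℂ)))
      (Mu : Matrix (Fin n) (Fin n) ℂ) := by
    have h0 : Commute A (Mu : Matrix (Fin n) (Fin n) ℂ) := congrArg Units.val h.commute
    rw [aeval_eq_sum_range]
    exact Commute.sum_left _ _ _ fun j _ => (h0.pow_left j).smul_left _
  refine ⟨s, inferInstance, fun a => Units.mk0 a (hne a), fun a => aeval A (Lagrange.basis s id a),
    ⟨hsum, hroot, fun a => ?_, hcomm, h.unipotent⟩, ⟨hsum, hroot, fun a => ?_, ?_, ?_⟩⟩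
  · rw [h.eq_mul, Units.val_mul, mul_assoc, ← (hcomm a).eq, ← mul_assoc, hmul, Units.val_mk0,
      smul_mul_assoc, mul_smul_comm]
  · rw [hmul, Units.val_mk0, Units.val_one, mul_smul_comm, mul_one]
  · exact fun a => by simp
  · simp

end Spectral

/-! ### The coordinate ring of the closure of a cyclic group -/

section Orbit

open Polynomial

variable {n : ℕ}

theorem mem_cyclicMatrixGroup_iff {M : GL (Fin n) ℂ} {A : Matrix (Fin n) (Fin n) ℂ} :
    A ∈ cyclicMatrixGroup M ↔
      ∃ k : ℤ, A = ((M ^ k : GL (Fin n) ℂ) : Matrix (Fin n) (Fin n) ℂ) := by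
  simp [cyclicMatrixGroup, Subgroup.mem_zpowers_iff]

/-- A polynomial function of matrices, restricted to the powers `M ^ k` and regarded as a function
of `k : ℤ`. The range of this map is the coordinate ring of the closure of `⟨M⟩`. -/
noncomputable def powerEvalHom (M : GL (Fin n) ℂ) :
    MvPolynomial (Fin n × Fin n) ℂ →ₐ[ℂ] (ℤ → ℂ) :=
  MvPolynomial.aeval fun ij k => ((M ^ k : GL (Fin n) ℂ) : Matrix (Fin n) (Fin n) ℂ) ij.1 ij.2

theorem powerEvalHom_apply (M : GL (Fin n) ℂ) (p : MvPolynomial (Fin n × Fin n) ℂ) (k : ℤ) :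
    powerEvalHom M p k = MvPolynomial.eval
      (matrixEntries ((M ^ k : GL (Fin n) ℂ) : Matrix (Fin n) (Fin n) ℂ)) p := by
  have h : (Pi.evalAlgHom ℂ (fun _ : ℤ => ℂ) k).comp (powerEvalHom M) = MvPolynomial.aeval
      (matrixEntries ((M ^ k : GL (Fin n) ℂ) : Matrix (Fin n) (Fin n) ℂ)) := by
    ext ij
    simp [powerEvalHom, matrixEntries]
  exact DFunLike.congr_fun h p

theorem ker_powerEvalHom (M : GL (Fin n) ℂ) :
    RingHom.ker (powerEvalHom M) = matrixVanishingIdeal (cyclicMatrixGroup M) := by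
  ext p
  rw [RingHom.mem_ker, mem_matrixVanishingIdeal, funext_iff]
  simp only [powerEvalHom_apply, mem_cyclicMatrixGroup_iff, Pi.zero_apply]
  exact ⟨fun h A ⟨k, hk⟩ => hk ▸ h k, fun h k => h _ ⟨k, rfl⟩⟩

theorem zariskiDim_zariskiClosure_cyclicMatrixGroup (M : GL (Fin n) ℂ) :
    zariskiDim (zariskiClosure (cyclicMatrixGroup M)) = ringKrullDim (powerEvalHom M).range := by
  rw [zariskiDim_zariskiClosure, ← ker_powerEvalHom]
  exact ringKrullDim_eq_of_ringEquiv (Ideal.quotientKerEquivRange (powerEvalHom M)).toRingEquiv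

theorem isIrreducible_cyclicMatrixGroup (M : GL (Fin n) ℂ) [IsDomain (powerEvalHom M).range] :
    @IsIrreducible _ (zariskiTopology n) (cyclicMatrixGroup M) := by
  rw [isIrreducible_zariski_iff, ← ker_powerEvalHom, ← AlgHom.ker_rangeRestrict]
  exact RingHom.ker_isPrime _

theorem mul_apply_mem_range_powerEvalHom (M : GL (Fin n) ℂ) (E : Matrix (Fin n) (Fin n) ℂ)
    (a b : Fin n) :
    (fun k : ℤ => (((M ^ k : GL (Fin n) ℂ) : Matrix (Fin n) (Fin n) ℂ) * E) a b) ∈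
      (powerEvalHom M).range := by
  refine ⟨∑ c, MvPolynomial.C (E c b) * MvPolynomial.X (a, c), funext fun k => ?_⟩
  simp [powerEvalHom_apply, matrixEntries, Matrix.mul_apply, mul_comm]

theorem range_powerEvalHom_le_iff {M : GL (Fin n) ℂ} {S : Subalgebra ℂ (ℤ → ℂ)} :
    (powerEvalHom M).range ≤ S ↔ ∀ a b : Fin n,
      (fun k : ℤ => ((M ^ k : GL (Fin n) ℂ) : Matrix (Fin n) (Fin n) ℂ) a b) ∈ S := by
  rw [powerEvalHom, ← Algebra.adjoin_range_eq_range_aeval, Algebra.adjoin_le_iff,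
    Set.range_subset_iff]
  exact Prod.forall

instance (M : GL (Fin n) ℂ) : Algebra.FiniteType ℂ (powerEvalHom M).range :=
  Algebra.FiniteType.of_surjective (powerEvalHom M).rangeRestrict
    (AlgHom.rangeRestrict_surjective _)

/-- The function `k ↦ u ^ k` on the integers. -/
def expFunction (u : ℂˣ) : ℤ → ℂ := fun k => ((u ^ k : ℂˣ) : ℂ)

namespace IsSpectralResolution

variable {ι : Type*} [Fintype ι] {M Ms U : GL (Fin n) ℂ} {lam : ι → ℂˣ}
  {e : ι → Matrix (Fin n) (Fin n) ℂ}

theorem expFunction_mem_range (h : IsSpectralResolution M U lam e) (i : ι) :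
    expFunction (lam i) ∈ (powerEvalHom M).range := by
  obtain ⟨E, hE, hk⟩ := h.exists_zpow_mul_eq_smul i
  obtain ⟨a, b, hab⟩ : ∃ a b, E a b ≠ 0 := by
    by_contra! hcon
    exact hE (Matrix.ext hcon)
  convert (powerEvalHom M).range.smul_mem
    (mul_apply_mem_range_powerEvalHom M E a b) (E a b)⁻¹ using 1
  ext k
  simp only [hk, Pi.smul_apply, Matrix.smul_apply, smul_eq_mul, expFunction]
  field_simp

theorem exists_expFunction_mul_mem_range (h : IsSpectralResolution M U lam e) (hU : U ≠ 1) :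
    ∃ i, expFunction (lam i) * (fun k : ℤ => (k : ℂ)) ∈ (powerEvalHom M).range := by
  obtain ⟨i, E, F, hF, -, hk⟩ := h.exists_zpow_mul_eq_smul_add hU
  obtain ⟨a, b, hab⟩ : ∃ a b, F a b ≠ 0 := by
    by_contra! hcon
    exact hF (Matrix.ext hcon)
  refine ⟨i, ?_⟩
  convert (powerEvalHom M).range.smul_mem ((powerEvalHom M).range.sub_mem
    (mul_apply_mem_range_powerEvalHom M E a b)
    ((powerEvalHom M).range.smul_mem (h.expFunction_mem_range i) (E a b))) (F a b)⁻¹ using 1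
  ext k
  simp only [hk, Pi.smul_apply, Pi.sub_apply, Pi.mul_apply, Matrix.smul_apply, Matrix.add_apply,
    smul_eq_mul, expFunction]
  field_simp
  ring

/-- The entries of `M ^ k` are quasi-polynomials in `k`: combinations of the `lam i ^ k` with
coefficients polynomial in `k`, which are constant if `U = 1`. -/
theorem range_powerEvalHom_le (h : IsSpectralResolution M U lam e) {S : Subalgebra ℂ (ℤ → ℂ)}
    (hS : ∀ i, expFunction (lam i) ∈ S) (hU : U ≠ 1 → (fun k : ℤ => (k : ℂ)) ∈ S) :
    (powerEvalHom M).range ≤ S := by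
  rw [range_powerEvalHom_le_iff]
  intro a b
  have hUk (c : Fin n) (d : Fin n) :
      (fun k : ℤ => ((U ^ k : GL (Fin n) ℂ) : Matrix (Fin n) (Fin n) ℂ) c d) ∈ S := by
    by_cases hU1 : U = 1
    · simp only [hU1, one_zpow, Units.val_one]
      exact S.algebraMap_mem ((1 : Matrix (Fin n) (Fin n) ℂ) c d)
    · obtain ⟨l, hl⟩ := h.unipotent
      have heq : (fun k : ℤ => ((U ^ k : GL (Fin n) ℂ) : Matrix (Fin n) (Fin n) ℂ) c d) =
          ∑ j ∈ Finset.range (l + 1), (((U : Matrix (Fin n) (Fin n) ℂ) - 1) ^ j) c d •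
            aeval (fun k : ℤ => (k : ℂ)) (binomialPolynomial j) := by
        ext k
        rw [zpow_eq_sum_binomialPolynomial hl, Finset.sum_apply, Matrix.sum_apply]
        refine Finset.sum_congr rfl fun j _ => ?_
        have haeval := aeval_algHom_apply (Pi.evalAlgHom ℂ (fun _ : ℤ => ℂ) k)
          (fun k : ℤ => (k : ℂ)) (binomialPolynomial j)
        simp only [Pi.evalAlgHom_apply, coe_aeval_eq_eval] at haeval
        rw [Matrix.smul_apply, Pi.smul_apply, ← haeval, smul_eq_mul, smul_eq_mul, mul_comm]
      rw [heq]
      exact S.sum_mem fun j _ => S.smul_mem (aeval_mem_adjoin_singleton ℂ _ |>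
        Algebra.adjoin_le (Set.singleton_subset_iff.mpr (hU hU1))) _
  have heq : (fun k : ℤ => ((M ^ k : GL (Fin n) ℂ) : Matrix (Fin n) (Fin n) ℂ) a b) =
      ∑ i, expFunction (lam i) * ∑ c, e i a c •
        (fun k : ℤ => ((U ^ k : GL (Fin n) ℂ) : Matrix (Fin n) (Fin n) ℂ) c b) := by
    ext k
    simp [h.zpow_eq k, Matrix.sum_apply, Matrix.mul_apply, expFunction, Finset.sum_apply]
  rw [heq]
  exact S.sum_mem fun i _ => S.mul_mem (hS i) (S.sum_mem fun c _ => S.smul_mem (hUk c b) _)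

end IsSpectralResolution

end Orbit

/-! ### The dimension when the eigenvalue group is torsion-free -/

section Dimension

open Polynomial

/-- Let `S ≤ R` be finitely generated subalgebras, `S` a domain, and `R ≤ S[t]` for an element `t`
that is transcendental over `S`. If `a * t ∈ R` for some nonzero `a ∈ S`, then `S[t]` is algebraic
over `R`, so that `dim R = dim S[t] = dim S + 1`. -/
theorem Subalgebra.ringKrullDim_eq_add_one {k F : Type*} [Field k] [CommRing F] [Algebra k F]
    {S R : Subalgebra k F} [IsDomain S] [Algebra.FiniteType k S] [Algebra.FiniteType k R] {t : F}
    (ht : Function.Injective (aeval t : S[X] →ₐ[S] F)) (hSR : S ≤ R)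
    (hR : R ≤ ((aeval t : S[X] →ₐ[S] F).restrictScalars k).range) {a : S} (ha : a ≠ 0)
    (hat : (a : F) * t ∈ R) : ringKrullDim R = ringKrullDim S + 1 := by
  let f : S[X] →ₐ[k] F := (aeval t : S[X] →ₐ[S] F).restrictScalars k
  have hf : Function.Injective f := ht
  let j : R →ₐ[k] S[X] :=
    ((AlgEquiv.ofInjective f hf).symm : f.range →ₐ[k] S[X]).comp (Subalgebra.inclusion hR)
  have hj (r : R) : f (j r) = r := by
    have h := congrArg Subtype.val
      ((AlgEquiv.ofInjective f hf).apply_symm_apply (Subalgebra.inclusion hR r))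
    exact h
  have hjinj : Function.Injective j := fun r r' h => Subtype.ext (by rw [← hj, ← hj, h])
  let _ : Algebra R S[X] := j.toRingHom.toAlgebra
  have : IsScalarTower k R S[X] := .of_algHom j
  have hmap (r : R) : algebraMap R S[X] r = j r := rfl
  have : FaithfulSMul R S[X] := (faithfulSMul_iff_algebraMap_injective _ _).mpr hjinj
  have : IsDomain R := hjinj.isDomain j.toRingHom
  have : IsNoetherianRing S := Algebra.FiniteType.isNoetherianRing k S
  have : Algebra.FiniteType k S[X] := Algebra.FiniteType.trans (S := S) inferInstance inferInstance
  have hC (s : S) : algebraMap R S[X] ⟨s, hSR s.2⟩ = C s := hf (by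
    rw [hmap, hj]
    simp [f])
  have hCX : algebraMap R S[X] ⟨a * t, hat⟩ = C a * X := hf (by
    rw [hmap, hj]
    simp [f])
  have hCalg (s : S) : IsAlgebraic R (C s : S[X]) := hC s ▸ isAlgebraic_algebraMap _
  have hXalg : IsAlgebraic R (X : S[X]) := by
    refine ⟨C ⟨a, hSR a.2⟩ * X - C ⟨a * t, hat⟩, fun h0 => ha ?_, ?_⟩
    · have h1 : (⟨a, hSR a.2⟩ : R) = 0 := by simpa using congrArg (coeff · 1) h0
      exact Subtype.ext (congrArg (Subtype.val : R → F) h1)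
    · simp [hC, hCX]
  have : Algebra.IsAlgebraic R S[X] := ⟨fun p => by
    induction p using Polynomial.induction_on' with
    | add p q hp hq => exact hp.add hq
    | monomial m s =>
      rw [← C_mul_X_pow_eq_monomial]
      exact (hCalg s).mul (hXalg.pow m)⟩
  rw [ringKrullDim_eq_of_isAlgebraic k R S[X], ringKrullDim_of_isNoetherianRing]

variable (Γ : Subgroup ℂˣ)

/-- Quasi-polynomials with frequencies in `Γ`, as functions on the integers. -/
noncomputable def quasiPolyHom : (MonoidAlgebra ℂ Γ)[X] →ₐ[ℂ] (ℤ → ℂ) :=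
  AlgHom.pi (quasiPolyEval Γ)

theorem quasiPolyHom_apply (P : (MonoidAlgebra ℂ Γ)[X]) (k : ℤ) :
    quasiPolyHom Γ P k = quasiPolyEval Γ k P := rfl

theorem quasiPolyHom_injective : Function.Injective (quasiPolyHom Γ) :=
  (injective_iff_map_eq_zero _).mpr fun _ h => quasiPolyEval_injective Γ (congrFun h)

theorem isDomain_of_le_range_quasiPolyHom [Group.FG Γ] [IsMulTorsionFree Γ]
    {S : Subalgebra ℂ (ℤ → ℂ)} (hS : S ≤ (quasiPolyHom Γ).range) : IsDomain S := by
  have := (AlgEquiv.ofInjective _ (quasiPolyHom_injective Γ)).symm.injective.isDomain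
    (AlgEquiv.ofInjective _ (quasiPolyHom_injective Γ)).symm.toRingHom
  exact (Subalgebra.inclusion_injective hS).isDomain (Subalgebra.inclusion hS).toRingHom

theorem expFunction_eq_quasiPolyHom (γ : Γ) :
    expFunction γ = quasiPolyHom Γ (C (MonoidAlgebra.single γ 1)) := by
  ext k
  rw [quasiPolyHom_apply, quasiPolyEval_single, one_mul]
  rfl

theorem intCast_eq_quasiPolyHom : (fun k : ℤ => (k : ℂ)) = quasiPolyHom Γ X := by
  ext k
  rw [quasiPolyHom_apply, quasiPolyEval_X]

/-- The function `k ↦ k` is transcendental over the exponential functions. -/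
theorem aeval_intCast_injective {S : Subalgebra ℂ (ℤ → ℂ)}
    (hS : ∀ s ∈ S, ∃ f, quasiPolyHom Γ (C f) = s) :
    Function.Injective (aeval (fun k : ℤ => (k : ℂ)) : S[X] →ₐ[S] (ℤ → ℂ)) := by
  choose f hf using fun s : S => hS s s.2
  have hf0 : f 0 = 0 := by
    have h := quasiPolyHom_injective Γ ((hf 0).trans (map_zero _).symm)
    exact C_eq_zero.mp h
  refine (injective_iff_map_eq_zero _).mpr fun P hP => ?_
  have h0 : ∑ j ∈ P.support, C (f (P.coeff j)) * X ^ j = 0 := by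
    apply quasiPolyHom_injective Γ
    rw [map_zero, ← hP, aeval_eq_sum_range' (Nat.lt_succ_self _), map_sum]
    refine Finset.sum_subset_zero_on_sdiff supp_subset_range_natDegree_succ (fun j hj => ?_)
      fun j _ => ?_
    · simp [notMem_support_iff.mp (Finset.mem_sdiff.mp hj).2]
    · rw [map_mul, map_pow, hf, ← intCast_eq_quasiPolyHom]
      rfl
  ext1 j
  by_cases hj : j ∈ P.support
  · have h1 := congrArg (coeff · j) h0
    simp only [finsetSum_coeff, coeff_C_mul_X_pow, Finset.sum_ite_eq, hj, if_true,
      coeff_zero] at h1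
    have h2 := hf (P.coeff j)
    rw [h1, C_0, map_zero] at h2
    exact Subtype.ext h2.symm
  · simpa using hj

variable {n : ℕ} {ι : Type*} [Fintype ι] {M Ms U : GL (Fin n) ℂ} {lam : ι → ℂˣ}
  {e : ι → Matrix (Fin n) (Fin n) ℂ}

instance {ι : Type*} [Finite ι] (lam : ι → ℂˣ) : Group.FG (Subgroup.closure (Set.range lam)) :=
  Group.closure_finite_fg _

theorem IsSpectralResolution.isDomain_range_powerEvalHom (h : IsSpectralResolution M U lam e)
    [IsMulTorsionFree (Subgroup.closure (Set.range lam))] : IsDomain (powerEvalHom M).range := by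
  refine isDomain_of_le_range_quasiPolyHom (Subgroup.closure (Set.range lam))
    (h.range_powerEvalHom_le (fun i => ?_) fun _ => ?_)
  · exact ⟨_, (expFunction_eq_quasiPolyHom _
      ⟨lam i, Subgroup.subset_closure (Set.mem_range_self i)⟩).symm⟩
  · exact ⟨_, (intCast_eq_quasiPolyHom _).symm⟩

theorem IsSpectralResolution.zariskiDim_eq_add_one_of_isMulTorsionFree
    (h : IsSpectralResolution M U lam e) (hs : IsSpectralResolution Ms 1 lam e) (hU : U ≠ 1)
    [IsMulTorsionFree (Subgroup.closure (Set.range lam))] :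
    zariskiDim (zariskiClosure (cyclicMatrixGroup M)) =
      zariskiDim (zariskiClosure (cyclicMatrixGroup Ms)) + 1 := by
  rw [zariskiDim_zariskiClosure_cyclicMatrixGroup, zariskiDim_zariskiClosure_cyclicMatrixGroup]
  set Γ := Subgroup.closure (Set.range lam)
  have : IsDomain (powerEvalHom Ms).range := hs.isDomain_range_powerEvalHom
  obtain ⟨i, hi⟩ := h.exists_expFunction_mul_mem_range hU
  have hle : (powerEvalHom Ms).range ≤ ((quasiPolyHom Γ).comp CAlgHom).range :=
    hs.range_powerEvalHom_le (fun i => ⟨_, (expFunction_eq_quasiPolyHom Γ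
      ⟨lam i, Subgroup.subset_closure (Set.mem_range_self i)⟩).symm⟩) fun h1 => absurd rfl h1
  refine Subalgebra.ringKrullDim_eq_add_one (t := fun k : ℤ => (k : ℂ))
    (a := ⟨expFunction (lam i), hs.expFunction_mem_range i⟩)
    (aeval_intCast_injective Γ fun s hs => hle hs) ?_ ?_ ?_ hi
  · exact hs.range_powerEvalHom_le h.expFunction_mem_range fun h1 => absurd rfl h1
  · refine h.range_powerEvalHom_le (fun i => ?_) fun _ => ?_
    · exact ⟨C ⟨_, hs.expFunction_mem_range i⟩, by simp⟩
    · exact ⟨X, by simp⟩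
  · intro h0
    have h1 := congrFun (congrArg Subtype.val h0) 0
    simp [expFunction] at h1

theorem zariskiDim_zariskiClosure_cyclicMatrixGroup_one :
    zariskiDim (zariskiClosure (cyclicMatrixGroup (1 : GL (Fin n) ℂ))) = 0 := by
  rw [zariskiDim_zariskiClosure_cyclicMatrixGroup]
  have hbot : (powerEvalHom (1 : GL (Fin n) ℂ)).range = ⊥ := by
    rw [eq_bot_iff, range_powerEvalHom_le_iff]
    intro a b
    simp only [one_zpow, Units.val_one]
    exact Subalgebra.algebraMap_mem _ ((1 : Matrix (Fin n) (Fin n) ℂ) a b)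
  rw [hbot, ringKrullDim_eq_of_ringEquiv (Algebra.botEquiv ℂ (ℤ → ℂ)).toRingEquiv,
    ringKrullDim_eq_zero_of_field]

end Dimension

/-! ### Cosets of a power and irreducible components -/

section Components

variable {n : ℕ}

theorem continuous_zariski_mul_left (B : Matrix (Fin n) (Fin n) ℂ) :
    @Continuous _ _ (zariskiTopology n) (zariskiTopology n) (fun A => B * A) := by
  let := zariskiTopology n
  rw [continuous_iff_isClosed]
  intro Z hZ
  obtain ⟨S, rfl⟩ := isClosed_zariskiTopology_iff.mp hZ
  let φ : MvPolynomial (Fin n × Fin n) ℂ →ₐ[ℂ] MvPolynomial (Fin n × Fin n) ℂ :=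
    MvPolynomial.aeval fun ij => ∑ c, MvPolynomial.C (B ij.1 c) * MvPolynomial.X (c, ij.2)
  have hφ (A : Matrix (Fin n) (Fin n) ℂ) (p : MvPolynomial (Fin n × Fin n) ℂ) :
      MvPolynomial.eval (fun ij : Fin n × Fin n => A ij.1 ij.2) (φ p) =
        MvPolynomial.eval (fun ij : Fin n × Fin n => (B * A) ij.1 ij.2) p := by
    have h : (MvPolynomial.aeval (fun ij : Fin n × Fin n => A ij.1 ij.2)).comp φ =
        MvPolynomial.aeval (R := ℂ) (fun ij : Fin n × Fin n => (B * A) ij.1 ij.2) := by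
      ext ij
      simp [φ, Matrix.mul_apply]
    exact DFunLike.congr_fun h p
  refine isClosed_zariskiTopology_iff.mpr ⟨φ '' S, ?_⟩
  ext A
  simp [hφ]

theorem zariskiDim_zariskiClosure_image_mul_left (g : GL (Fin n) ℂ)
    (S : Set (Matrix (Fin n) (Fin n) ℂ)) :
    zariskiDim (zariskiClosure ((fun A => (g : Matrix (Fin n) (Fin n) ℂ) * A) '' S)) =
      zariskiDim (zariskiClosure S) := by
  let := zariskiTopology n
  let H : Matrix (Fin n) (Fin n) ℂ ≃ₜ Matrix (Fin n) (Fin n) ℂ :=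
    { toFun := fun A => (g : Matrix (Fin n) (Fin n) ℂ) * A
      invFun := fun A => ((g⁻¹ : GL (Fin n) ℂ) : Matrix (Fin n) (Fin n) ℂ) * A
      left_inv := fun A => by simp [← mul_assoc]
      right_inv := fun A => by simp [← mul_assoc]
      continuous_toFun := continuous_zariski_mul_left _
      continuous_invFun := continuous_zariski_mul_left _ }
  change topologicalKrullDim (closure (H '' S)) = topologicalKrullDim (closure S)
  rw [← H.image_closure]
  exact (IsHomeomorph.topologicalKrullDim_eq _ (H.image (closure S)).isHomeomorph).symm

theorem cyclicMatrixGroup_eq_iUnion (M : GL (Fin n) ℂ) {d : ℕ} (hd : d ≠ 0) :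
    cyclicMatrixGroup M = ⋃ r : Fin d,
      (fun A => ((M ^ (r : ℕ) : GL (Fin n) ℂ) : Matrix (Fin n) (Fin n) ℂ) * A) ''
        cyclicMatrixGroup (M ^ d) := by
  ext A
  simp only [mem_cyclicMatrixGroup_iff, Set.mem_iUnion, Set.mem_image]
  constructor
  · rintro ⟨k, rfl⟩
    have hd' : (0 : ℤ) < d := by lia
    have h0 := Int.emod_nonneg k hd'.ne'
    have h1 := Int.emod_lt_of_pos k hd'
    refine ⟨⟨(k % d).toNat, by lia⟩, _, ⟨k / d, rfl⟩, ?_⟩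
    rw [← Units.val_mul, ← zpow_natCast, ← zpow_natCast M d, ← zpow_mul, ← zpow_add,
      Int.toNat_of_nonneg h0, Int.emod_add_mul_ediv]
  · rintro ⟨r, _, ⟨k, rfl⟩, rfl⟩
    exact ⟨r + d * k, by rw [zpow_add, zpow_mul, zpow_natCast, zpow_natCast, Units.val_mul]⟩

/-- The closure of the coset `M ^ r * ⟨M ^ d⟩`. -/
def cosetClosure (M : GL (Fin n) ℂ) (d r : ℕ) : Set (Matrix (Fin n) (Fin n) ℂ) :=
  zariskiClosure ((fun A => ((M ^ r : GL (Fin n) ℂ) : Matrix (Fin n) (Fin n) ℂ) * A) ''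
    cyclicMatrixGroup (M ^ d))

theorem isClosed_cosetClosure (M : GL (Fin n) ℂ) (d r : ℕ) :
    @IsClosed _ (zariskiTopology n) (cosetClosure M d r) :=
  @isClosed_closure _ (zariskiTopology n) _

theorem zariskiClosure_cyclicMatrixGroup_eq_iUnion (M : GL (Fin n) ℂ) {d : ℕ} (hd : d ≠ 0) :
    zariskiClosure (cyclicMatrixGroup M) = ⋃ r : Fin d, cosetClosure M d r := by
  rw [cyclicMatrixGroup_eq_iUnion M hd]
  let := zariskiTopology n
  exact closure_iUnion_of_finite _

theorem zariskiDim_zariskiClosure_cyclicMatrixGroup_pow (M : GL (Fin n) ℂ) {d : ℕ} (hd : d ≠ 0) :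
    zariskiDim (zariskiClosure (cyclicMatrixGroup M)) =
      zariskiDim (zariskiClosure (cyclicMatrixGroup (M ^ d))) := by
  let := zariskiTopology n
  have hdim (r : Fin d) : topologicalKrullDim (cosetClosure M d r) =
      topologicalKrullDim (zariskiClosure (cyclicMatrixGroup (M ^ d))) :=
    zariskiDim_zariskiClosure_image_mul_left (M ^ (r : ℕ)) (cyclicMatrixGroup (M ^ d))
  rw [zariskiClosure_cyclicMatrixGroup_eq_iUnion M hd]
  apply le_antisymm
  · exact topologicalKrullDim_iUnion_le (fun r : Fin d => isClosed_cosetClosure M d r)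
      fun r => (hdim r).le
  · let r : Fin d := ⟨0, Nat.pos_of_ne_zero hd⟩
    refine (hdim r).symm.le.trans ?_
    exact (Topology.IsEmbedding.inclusion
      (Set.subset_iUnion (fun r : Fin d => cosetClosure M d r) r)).isInducing.topologicalKrullDim_le

theorem finite_torsion_of_fg (G : Type*) [CommGroup G] [Group.FG G] :
    Finite (CommGroup.torsion G) := by
  have : Module.Finite ℤ (Additive G) := Module.Finite.iff_addGroup_fg.mpr inferInstance
  let N : Submodule ℤ (Additive G) :=
    AddSubgroup.toIntSubmodule (Subgroup.toAddSubgroup (CommGroup.torsion G))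
  have hfg : AddGroup.FG N := Module.Finite.iff_addGroup_fg.mp inferInstance
  have : Finite N := AddCommGroup.finite_of_fg_isAddTorsion N fun x => by
    have hx : IsOfFinOrder (x : Additive G).toMul := x.2
    obtain ⟨m, hm, hxm⟩ := isOfFinOrder_iff_pow_eq_one.mp hx
    exact isOfFinAddOrder_iff_nsmul_eq_zero.mpr ⟨m, hm, Subtype.ext hxm⟩
  exact Finite.of_injective (β := N) (fun x => ⟨Additive.ofMul x, x.2⟩) fun x y h =>
    Subtype.ext (congrArg (fun z : N => (z : Additive G).toMul) h)

variable {ι : Type*} [Fintype ι] {M U : GL (Fin n) ℂ} {lam : ι → ℂˣ}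
  {e : ι → Matrix (Fin n) (Fin n) ℂ}

theorem isMulTorsionFree_closure_range_pow_card_torsion {ι : Type*} (lam : ι → ℂˣ)
    [Finite (CommGroup.torsion (Subgroup.closure (Set.range lam)))] :
    IsMulTorsionFree (Subgroup.closure (Set.range fun i =>
      lam i ^ Nat.card (CommGroup.torsion (Subgroup.closure (Set.range lam))))) := by
  set d := Nat.card (CommGroup.torsion (Subgroup.closure (Set.range lam)))
  rw [CommGroup.isMulTorsionFree_iff_torsion_eq_bot, eq_bot_iff]
  rintro ⟨γ, hγ⟩ hfin
  have hmap : Subgroup.closure (Set.range fun i => lam i ^ d) =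
      (Subgroup.closure (Set.range lam)).map (powMonoidHom d) := by
    rw [MonoidHom.map_closure, ← Set.range_comp]
    rfl
  obtain ⟨δ, hδ, rfl⟩ := hmap ▸ hγ
  have h1 : IsOfFinOrder (δ ^ d) := (Submonoid.isOfFinOrder_coe).mpr hfin
  have h2 : IsOfFinOrder δ := h1.of_pow Nat.card_pos.ne'
  have h3 := pow_card_eq_one' (x := (⟨⟨δ, hδ⟩, (CommGroup.mem_torsion _).mpr
    ((Submonoid.isOfFinOrder_coe).mp h2)⟩ :
      CommGroup.torsion (Subgroup.closure (Set.range lam))))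
  exact Subtype.ext (congrArg (fun γ : CommGroup.torsion (Subgroup.closure (Set.range lam)) =>
    ((γ : Subgroup.closure (Set.range lam)) : ℂˣ)) h3)

/-- Every element of the group generated by the eigenvalues is a quotient of two products of
eigenvalues, whose powers are polynomial functions of the powers of `M`. -/
theorem IsSpectralResolution.exists_expFunction_div (h : IsSpectralResolution M U lam e) {ζ : ℂˣ}
    (hζ : ζ ∈ Subgroup.closure (Set.range lam)) :
    ∃ a b : ℂˣ, a = ζ * b ∧ expFunction a ∈ (powerEvalHom M).range ∧
      expFunction b ∈ (powerEvalHom M).range := by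
  have hmul (a b : ℂˣ) : expFunction (a * b) = expFunction a * expFunction b := by
    ext k
    simp [expFunction, mul_zpow]
  have hone : expFunction 1 ∈ (powerEvalHom M).range := by
    convert (powerEvalHom M).range.one_mem using 1
    ext k
    simp [expFunction]
  induction hζ using Subgroup.closure_induction with
  | mem x hx =>
    obtain ⟨i, rfl⟩ := hx
    exact ⟨lam i, 1, (mul_one _).symm, h.expFunction_mem_range i, hone⟩
  | one => exact ⟨1, 1, (mul_one _).symm, hone, hone⟩
  | mul x y _ _ hx hy =>
    obtain ⟨a, b, rfl, ha, hb⟩ := hx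
    obtain ⟨a', b', rfl, ha', hb'⟩ := hy
    exact ⟨_, b * b', mul_mul_mul_comm x b y b', hmul (x * b) (y * b') ▸
      Subalgebra.mul_mem _ ha ha', hmul b b' ▸ Subalgebra.mul_mem _ hb hb'⟩
  | inv x _ hx =>
    obtain ⟨a, b, rfl, ha, hb⟩ := hx
    exact ⟨b, x * b, by rw [inv_mul_cancel_left], hb, ha⟩

/-- The closures of the cosets of `⟨M ^ d⟩` are separated by a primitive `d`-th root of unity in
the group generated by the eigenvalues. -/
theorem IsSpectralResolution.eq_of_cosetClosure_subset (h : IsSpectralResolution M U lam e)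
    {ζ : ℂˣ} (hζ : ζ ∈ Subgroup.closure (Set.range lam)) {d : ℕ} (hd : orderOf ζ = d) {r s : Fin d}
    (hrs : cosetClosure M d r ⊆ cosetClosure M d s) : r = s := by
  obtain ⟨a, b, rfl, ⟨p, hp⟩, ⟨q, hq⟩⟩ := h.exists_expFunction_div hζ
  have hpq (k : ℤ) (c : ℂ) : MvPolynomial.eval
      (matrixEntries ((M ^ k : GL (Fin n) ℂ) : Matrix (Fin n) (Fin n) ℂ))
        (p - MvPolynomial.C c * q) = (((ζ ^ k : ℂˣ) : ℂ) - c) * ((b ^ k : ℂˣ) : ℂ) := by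
    have hp' := congrFun hp k
    have hq' := congrFun hq k
    rw [AlgHom.toRingHom_eq_coe, RingHom.coe_coe, powerEvalHom_apply] at hp' hq'
    rw [map_sub, map_mul, MvPolynomial.eval_C, hp', hq', expFunction, expFunction, mul_zpow,
      Units.val_mul]
    ring
  -- The polynomial `p - ζ ^ s * q` vanishes on the coset of `s`.
  have hs : cosetClosure M d s ⊆
      matrixZeroLocus (Ideal.span {p - MvPolynomial.C ((ζ ^ (s : ℤ) : ℂˣ) : ℂ) * q}) := by
    let := zariskiTopology n
    refine closure_minimal ?_
      (isClosed_zariskiTopology_iff.mpr (isZariskiClosed_matrixZeroLocus _))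
    rw [subset_matrixZeroLocus_iff, Ideal.span_singleton_le_iff_mem, mem_matrixVanishingIdeal]
    rintro _ ⟨_, hA, rfl⟩
    obtain ⟨k, rfl⟩ := mem_cyclicMatrixGroup_iff.mp hA
    have hζd : ζ ^ d = 1 := hd ▸ pow_orderOf_eq_one ζ
    have hζk : ζ ^ ((s : ℤ) + d * k) = ζ ^ (s : ℤ) := by
      rw [zpow_add, _root_.zpow_mul, zpow_natCast ζ d, hζd, one_zpow, mul_one]
    have hM : ((M ^ (s : ℕ) : GL (Fin n) ℂ) : Matrix (Fin n) (Fin n) ℂ) *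
        (((M ^ d) ^ k : GL (Fin n) ℂ) : Matrix (Fin n) (Fin n) ℂ) =
        ((M ^ ((s : ℤ) + d * k) : GL (Fin n) ℂ) : Matrix (Fin n) (Fin n) ℂ) := by
      rw [zpow_add, _root_.zpow_mul, zpow_natCast, zpow_natCast, Units.val_mul]
    beta_reduce
    rw [hM, hpq, hζk, sub_self, zero_mul]
  have hr : ((M ^ (r : ℕ) : GL (Fin n) ℂ) : Matrix (Fin n) (Fin n) ℂ) ∈ cosetClosure M d r :=
    @subset_closure _ (zariskiTopology n) _ _
      ⟨1, mem_cyclicMatrixGroup_iff.mpr ⟨0, by simp⟩, mul_one _⟩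
  have h0 := hs (hrs hr) _ (Ideal.mem_span_singleton_self _)
  rw [← zpow_natCast, hpq, mul_eq_zero, or_iff_left (Units.ne_zero _), sub_eq_zero, Units.val_inj,
    zpow_natCast, zpow_natCast] at h0
  exact Fin.ext (pow_injOn_Iio_orderOf (hd ▸ r.2) (hd ▸ s.2) h0)

theorem exists_orderOf_eq_card_torsion (G : Type*) [CommGroup G] [Finite (CommGroup.torsion G)]
    (f : G →* ℂˣ) (hf : Function.Injective f) :
    ∃ ζ : G, orderOf ζ = Nat.card (CommGroup.torsion G) := by
  have : IsCyclic (CommGroup.torsion G) := isCyclic_of_injective_ringHom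
    (((Units.coeHom ℂ).comp f).comp (CommGroup.torsion G).subtype)
    ((Units.val_injective.comp hf).comp Subtype.val_injective)
  obtain ⟨ζ, hζ⟩ := IsCyclic.exists_generator (α := CommGroup.torsion G)
  exact ⟨ζ, by rw [Subgroup.orderOf_coe, orderOf_eq_card_of_forall_mem_zpowers hζ]⟩

/-- The number of components of the closure of `⟨M⟩` is the order of the torsion subgroup of the
group generated by the eigenvalues of `M`. -/
theorem IsSpectralResolution.numIrredComponents_eq (h : IsSpectralResolution M U lam e) :
    numIrredComponents (zariskiClosure (cyclicMatrixGroup M)) =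
      Nat.card (CommGroup.torsion (Subgroup.closure (Set.range lam))) := by
  have hfin := finite_torsion_of_fg (Subgroup.closure (Set.range lam))
  obtain ⟨ζ, hζ⟩ := exists_orderOf_eq_card_torsion (Subgroup.closure (Set.range lam))
    (Subgroup.closure (Set.range lam)).subtype Subtype.val_injective
  set d := Nat.card (CommGroup.torsion (Subgroup.closure (Set.range lam)))
  have hd0 : d ≠ 0 := Nat.card_pos.ne'
  have htf : IsMulTorsionFree (Subgroup.closure (Set.range fun i => lam i ^ d)) :=
    isMulTorsionFree_closure_range_pow_card_torsion lam
  have := (h.pow d).isDomain_range_powerEvalHom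
  rw [zariskiClosure_cyclicMatrixGroup_eq_iUnion M hd0]
  refine (@encard_irreducibleComponents_iUnion _ (Fin d) (zariskiTopology n) _
    (fun r => cosetClosure M d r) (fun r => isClosed_cosetClosure M d r) (fun r => ?_)
    fun r s hrs => ?_).trans ?_
  · exact @IsIrreducible.closure _ (zariskiTopology n) _
      (@IsIrreducible.image _ _ (zariskiTopology n) (zariskiTopology n) _
        (isIrreducible_cyclicMatrixGroup (M ^ d)) _
        (@Continuous.continuousOn _ _ (zariskiTopology n) (zariskiTopology n) _ _
          (continuous_zariski_mul_left _)))
  · exact h.eq_of_cosetClosure_subset ζ.2 (by rw [Subgroup.orderOf_coe, hζ]) hrs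
  · simp

theorem IsSpectralResolution.zariskiDim_eq_add_one {Ms : GL (Fin n) ℂ}
    (h : IsSpectralResolution M U lam e) (hs : IsSpectralResolution Ms 1 lam e) (hU : U ≠ 1) :
    zariskiDim (zariskiClosure (cyclicMatrixGroup M)) =
      zariskiDim (zariskiClosure (cyclicMatrixGroup Ms)) + 1 := by
  have hfin := finite_torsion_of_fg (Subgroup.closure (Set.range lam))
  set d := Nat.card (CommGroup.torsion (Subgroup.closure (Set.range lam)))
  have hd0 : d ≠ 0 := Nat.card_pos.ne'
  have htf : IsMulTorsionFree (Subgroup.closure (Set.range fun i => lam i ^ d)) :=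
    isMulTorsionFree_closure_range_pow_card_torsion lam
  rw [zariskiDim_zariskiClosure_cyclicMatrixGroup_pow M hd0,
    zariskiDim_zariskiClosure_cyclicMatrixGroup_pow Ms hd0]
  exact (h.pow d).zariskiDim_eq_add_one_of_isMulTorsionFree
    (by simpa using hs.pow d) (h.pow_ne_one hU hd0)

end Components

theorem mainTheorem7 (n : ℕ) (M Ms Mu : GL (Fin n) ℂ) (h : IsJordanDecomposition M Ms Mu) :
    zariskiDim (zariskiClosure (cyclicMatrixGroup M)) =
        zariskiDim (zariskiClosure (cyclicMatrixGroup Ms)) +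
          zariskiDim (zariskiClosure (cyclicMatrixGroup Mu)) ∧
      numIrredComponents (zariskiClosure (cyclicMatrixGroup M)) =
        numIrredComponents (zariskiClosure (cyclicMatrixGroup Ms)) := by
  obtain ⟨ι, _, lam, e, hM, hMs⟩ := h.exists_isSpectralResolution
  refine ⟨?_, by rw [hM.numIrredComponents_eq, hMs.numIrredComponents_eq]⟩
  by_cases hU : Mu = 1
  · rw [h.eq_mul, hU, mul_one, zariskiDim_zariskiClosure_cyclicMatrixGroup_one, add_zero]
  · -- The dimension of the closure of `⟨Mu⟩` is the case of the decomposition `Mu = 1 * Mu`.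
    have hJ : IsJordanDecomposition Mu 1 Mu :=
      ⟨(one_mul _).symm, Commute.one_left _, by
        rw [Units.val_one, Matrix.toLin'_one]
        exact Module.End.isSemisimple_id, h.unipotent⟩
    obtain ⟨κ, _, mu, f, hMu, hone⟩ := hJ.exists_isSpectralResolution
    rw [hM.zariskiDim_eq_add_one hMs hU, hMu.zariskiDim_eq_add_one hone hU,
      zariskiDim_zariskiClosure_cyclicMatrixGroup_one, zero_add]
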